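/- Let $G=(V,E)$ be a finite graph. The edge-model joining process on $G$ is the following. Initially every vertex is active. As long as some edge of $G$ joins two active vertices, choose a directed edge $(v,u)$ between active vertices of $G$ uniformly at random (each edge of $G$ giving two directed edges); then $v$ becomes passive and directs an edge to $u$. The process ends when no edge of $G$ joins two active vertices. At the end, the vertices are partitioned into fragments, each being a directed tree rooted at exactly one active vertex. For $n\ge 1$, $N=\binom n2$ and $0\le m\le N$, let $G(n,m)$ be a uniformly random graph on $n$ labelled vertices with exactly $m$ edges, and let $a(m)$ be the number of active vertices (equivalently, of fragments) at the end of the edge-model joining process run on $G(n,m)$. (i) Let $\omega=\omega(n)\to\infty$ as $n\to\infty$, and let $m=m(n)$ be integers with $0\le m\le N$ and $m\le N/\omega$ for all large $n$. Then, as $n\to\infty$, $a(m)$ is concentrated: for every $\varepsilon>0$, $$\mathbb P\bigl(|a(m)-\mathbb E\,a(m)|\ge \varepsilon\,\mathbb E\,a(m)\bigr)\to 0,$$ and $$\mathbb E\,a(m)\sim \frac{1}{1-(1-1/n)\sqrt{1-m/N}},\qquad \mathbb E\,a(m)\sim\frac{n^2}{n+m}.$$ (ii) For every $n\ge 2$ and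 every $0\le m\le N$ (in particular for every $m\le N(1-o(1))$), $$\mathbb E\,a(m)\le \frac{1}{1-(1-1/n)\sqrt{1-m/N}}.$$ -/

import Mathlib

open Filter Asymptotics
open scoped Topology

noncomputable section

namespace Joining

/-- A state of the joining protocol on the vertex set `V`. The value `σ v = none` means that `v` is
active; `σ v = some u` means that `v` is passive and directs an edge to `u` in the fragment graph.
The fragments are the resulting directed trees, each rooted at its unique active vertex. -/
abbrev State (V : Type*) := V → Option V

/-- Initially all vertices are active. -/
def initial (V : Type*) : State V := fun _ => none

section Protocol

open scoped Classical

variable {V : Type*} [Fintype V]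

/-- The set of active vertices; it has one element for each fragment. -/
def active (σ : State V) : Finset V := Finset.univ.filter fun v => σ v = none

/-- The directed edges `(v, u)` of `G` between active vertices. -/
def activeEdges (G : SimpleGraph V) (σ : State V) : Finset (V × V) :=
  Finset.univ.filter fun e => G.Adj e.1 e.2 ∧ e.1 ∈ active σ ∧ e.2 ∈ active σ

/-- One step of the edge model: a directed edge `(v, u)` between active vertices is chosen
uniformly at random, `v` becomes passive and directs an edge to `u`. If all active vertices are
isolated, the process has ended and the state no longer changes. -/
def step (G : SimpleGraph V) (σ : State V) : PMF (State V) :=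
  if h : (activeEdges G σ).Nonempty then
    (PMF.uniformOfFinset (activeEdges G σ) h).map fun e => Function.update σ e.1 (some e.2)
  else PMF.pure σ

/-- The law of the state after `k` steps of the edge model on `G`. -/
def run (G : SimpleGraph V) : ℕ → PMF (State V)
  | 0 => PMF.pure (initial V)
  | k + 1 => (run G k).bind (step G)

/-- The law of the state at the end of the process. Every step before the end makes one vertex
passive, so the process has ended after at most `|V|` steps (see `activeEdges_of_mem_final`). -/
def final (G : SimpleGraph V) : PMF (State V) := run G (Fintype.card V)

theorem run_support (G : SimpleGraph V) (k : ℕ) (σ : State V) (hσ : σ ∈ (run G k).support) :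
    activeEdges G σ = ∅ ∨ (active σ).card + k = Fintype.card V := by
  induction k generalizing σ with
  | zero =>
    right
    simp only [run, PMF.support_pure, Set.mem_singleton_iff] at hσ
    subst hσ
    simp [active, initial]
  | succ k ih =>
    simp only [run, PMF.mem_support_bind_iff] at hσ
    obtain ⟨τ, hτ, hs⟩ := hσ
    unfold step at hs
    split_ifs at hs with h
    · right
      rw [PMF.mem_support_map_iff] at hs
      obtain ⟨e, he, rfl⟩ := hs
      rw [PMF.mem_support_uniformOfFinset_iff] at he
      rcases ih τ hτ with h0 | h1
      · simp [h0] at h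
      · have hmem : e.1 ∈ active τ := by
          simp only [activeEdges, Finset.mem_filter] at he
          exact he.2.2.1
        have : active (Function.update τ e.1 (some e.2)) = (active τ).erase e.1 := by
          ext w
          by_cases hw : w = e.1
          · subst hw; simp [active]
          · simp [active, hw]
        rw [this]
        have := Finset.card_erase_add_one hmem
        omega
    · left
      simp only [PMF.support_pure, Set.mem_singleton_iff] at hs
      subst hs
      exact Finset.not_nonempty_iff_eq_empty.mp h

/-- In the final state all active vertices are isolated. -/
theorem activeEdges_of_mem_final (G : SimpleGraph V) (σ : State V)
    (hσ : σ ∈ (final G).support) : activeEdges G σ = ∅ := by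
  rcases run_support G _ σ hσ with h | h
  · exact h
  · have h0 : active σ = ∅ := by
      rw [← Finset.card_eq_zero]
      omega
    simp [activeEdges, h0]

/-- The graphs on `V` with exactly `m` edges. -/
def graphsWith (V : Type*) [Fintype V] (m : ℕ) : Finset (SimpleGraph V) :=
  Finset.univ.filter fun G => G.edgeFinset.card = m

theorem graphsWith_nonempty {n m : ℕ} (hm : m ≤ n.choose 2) :
    (graphsWith (Fin n) m).Nonempty := by
  have hc : m ≤ ((⊤ : SimpleGraph (Fin n)).edgeFinset).card := by
    rw [SimpleGraph.card_edgeFinset_top_eq_card_choose_two, Fintype.card_fin]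
    exact hm
  obtain ⟨s, hs, hcard⟩ := Finset.exists_subset_card_eq hc
  refine ⟨SimpleGraph.fromEdgeSet (s : Set (Sym2 (Fin n))), ?_⟩
  simp only [graphsWith, Finset.mem_filter, Finset.mem_univ, true_and]
  rw [← hcard]
  congr 1
  ext e
  have := fun h : e ∈ s => hs h
  simp only [SimpleGraph.mem_edgeFinset, SimpleGraph.edgeSet_fromEdgeSet, Set.mem_sdiff,
    SimpleGraph.edgeSet_top] at this ⊢
  constructor
  · exact fun h => h.1
  · exact fun h => ⟨h, this h⟩

/-- The random graph `G(n, m)`: uniform over all graphs on `n` labelled vertices with `m` edges. -/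
def gnm (n m : ℕ) (hm : m ≤ n.choose 2) : PMF (SimpleGraph (Fin n)) :=
  PMF.uniformOfFinset (graphsWith (Fin n) m) (graphsWith_nonempty hm)

end Protocol

/-- The law of `a(m)`, the number of active vertices (that is, of fragments) at the end of the
edge-model joining process run on the random graph `G(n, m)`. -/
def activeLaw (n m : ℕ) (hm : m ≤ n.choose 2) : PMF ℕ :=
  (gnm n m hm).bind fun G => (final G).map fun σ => (active σ).card

/-- The expectation `E a(m)`. -/
def expectedActive (n m : ℕ) (hm : m ≤ n.choose 2) : ℝ :=
  ∫ k : ℕ, (k : ℝ) ∂(activeLaw n m hm).toMeasure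

/-- The function `1 / (1 - (1 - 1/n) √(1 - m/N))` with `N = n.choose 2`. -/
def meanField (n m : ℕ) : ℝ :=
  1 / (1 - (1 - 1 / (n : ℝ)) * Real.sqrt (1 - (m : ℝ) / (n.choose 2 : ℝ)))

end Joining

end

/-
Withhold a uniformly random edge of `G(n, m + 1)` and let it be offered to the process on the other
`m` edges when that process has ended: it then reduces the number `k` of active vertices by one
with probability `k (k - 1) / 2` divided by the number of pairs not yet used. This expresses
`E φ(a(m + 1))` through the law of `a(m)`.

For `φ k = 1 / (k + 1)` the recurrence closes up, and `X = a(m) + 1` has harmonic mean exactly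
`B = n (n + 1) / (n + m)`. Since `(X - B)² / (B X) = X / B + B / X - 2`, its expectation is
`E X / B - 1`; so `E X ≥ B`, and an upper bound `E X ≤ B + O(1)` gives concentration by Markov's
inequality. For `φ k = k`, Jensen's inequality turns the recurrence into such an upper bound: the
mean field satisfies the reverse inequality.
-/

namespace Joining

open MeasureTheory
open scoped BigOperators

section Arcs

variable {V : Type*} {G : SimpleGraph V} {S : Finset V} {e : V × V}

open Classical in
/-- The directed edges of `G` inside `S`; the directed edges available to the joining process when
`S` is the set of active vertices. -/
noncomputable def arcs (G : SimpleGraph V) (S : Finset V) : Finset (V × V) :=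
  G.interedges S S

theorem mem_arcs : e ∈ arcs G S ↔ e.1 ∈ S ∧ e.2 ∈ S ∧ G.Adj e.1 e.2 := by
  classical exact G.mem_interedges_iff

theorem swap_mem_arcs : e.swap ∈ arcs G S ↔ e ∈ arcs G S := by
  classical exact G.swap_mem_interedges_iff

@[simp]
theorem arcs_empty (G : SimpleGraph V) : arcs G ∅ = ∅ := by
  classical exact G.interedges_empty_left ∅

theorem arcs_erase_subset [DecidableEq V] (G : SimpleGraph V) (S : Finset V) (e : V × V) :
    arcs G (S.erase e.1) ⊆ arcs G S \ {e, e.swap} := by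
  intro f hf
  simp only [mem_arcs, Finset.mem_erase] at hf
  simp only [Finset.mem_sdiff, mem_arcs, Finset.mem_insert, Finset.mem_singleton, not_or]
  refine ⟨⟨hf.1.2, hf.2.1.2, hf.2.2⟩, ?_, ?_⟩
  · rintro rfl
    exact hf.1.1 rfl
  · rintro rfl
    exact hf.2.1.1 rfl

theorem arcs_deleteEdges [DecidableEq V] (G : SimpleGraph V) (S : Finset V) (e : V × V) :
    arcs (G.deleteEdges {s(e.1, e.2)}) S = arcs G S \ {e, e.swap} := by
  ext ⟨a, b⟩
  obtain ⟨c, d⟩ := e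
  simp only [mem_arcs, SimpleGraph.deleteEdges_adj, Set.mem_singleton_iff, Sym2.eq_iff,
    Finset.mem_sdiff, Finset.mem_insert, Finset.mem_singleton, Prod.swap_prod_mk, Prod.mk.injEq]
  tauto

theorem card_arcs_deleteEdges (he : e ∈ arcs G S) :
    (arcs (G.deleteEdges {s(e.1, e.2)}) S).card + 2 = (arcs G S).card := by
  classical
  have hne : e ≠ e.swap := fun h => (mem_arcs.mp he).2.2.ne (congrArg Prod.fst h)
  rw [arcs_deleteEdges, ← Finset.card_pair hne]
  refine Finset.card_sdiff_add_card_eq_card ?_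
  simp [Finset.insert_subset_iff, he, swap_mem_arcs]

end Arcs

section Transition

variable {V : Type*} [DecidableEq V] {G : SimpleGraph V} {S : Finset V}

/-- The transition operator of the joining process on sets of active vertices: `transition G ψ S` is
the expectation of `ψ` after one step from `S`. Hence `(transition G ^ k) ψ S` is the expectation
of `ψ` after `k` steps. -/
noncomputable def transition (G : SimpleGraph V) : Module.End ℝ (Finset V → ℝ) where
  toFun ψ S := if (arcs G S).Nonempty then 𝔼 e ∈ arcs G S, ψ (S.erase e.1) else ψ S
  map_add' ψ χ := by
    ext S
    simp only [Pi.add_apply, Finset.expect_add_distrib]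
    split_ifs <;> rfl
  map_smul' c ψ := by
    ext S
    simp only [Pi.smul_apply, ← Finset.smul_expect, RingHom.id_apply]
    split_ifs <;> rfl

theorem transition_of_nonempty (h : (arcs G S).Nonempty) (ψ : Finset V → ℝ) :
    transition G ψ S = 𝔼 e ∈ arcs G S, ψ (S.erase e.1) :=
  if_pos h

theorem transition_of_arcs_eq_empty (h : arcs G S = ∅) (ψ : Finset V → ℝ) :
    transition G ψ S = ψ S :=
  if_neg (Finset.not_nonempty_iff_eq_empty.mpr h)

theorem card_mul_transition (G : SimpleGraph V) (ψ : Finset V → ℝ) (S : Finset V) :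
    ((arcs G S).card : ℝ) * transition G ψ S = ∑ e ∈ arcs G S, ψ (S.erase e.1) := by
  rcases (arcs G S).eq_empty_or_nonempty with h | h
  · simp [h]
  · rw [transition_of_nonempty h, Finset.card_mul_expect]

theorem transition_pow_succ (G : SimpleGraph V) (k : ℕ) (ψ : Finset V → ℝ) :
    (transition G ^ (k + 1)) ψ = transition G ((transition G ^ k) ψ) := by
  rw [pow_succ', Module.End.mul_apply]

theorem transition_pow_of_arcs_eq_empty (h : arcs G S = ∅) (k : ℕ) (ψ : Finset V → ℝ) :
    (transition G ^ k) ψ S = ψ S := by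
  induction k with
  | zero => rfl
  | succ k ih => rw [transition_pow_succ, transition_of_arcs_eq_empty h, ih]

theorem transition_const (G : SimpleGraph V) (c : ℝ) :
    transition G (fun _ => c) = fun _ => c := by
  ext S
  rcases (arcs G S).eq_empty_or_nonempty with h | h
  · exact transition_of_arcs_eq_empty h _
  · rw [transition_of_nonempty h, Finset.expect_const h]

theorem transition_pow_const (G : SimpleGraph V) (k : ℕ) (c : ℝ) :
    (transition G ^ k) (fun _ => c) = fun _ => c := by
  induction k with
  | zero => rfl
  | succ k ih => rw [transition_pow_succ, ih, transition_const]

theorem transition_pow_congr {H : SimpleGraph V} {ψ χ : Finset V → ℝ}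
    (hGH : ∀ T ⊆ S, arcs G T = arcs H T) (hψ : ∀ T ⊆ S, ψ T = χ T) (k : ℕ) :
    (transition G ^ k) ψ S = (transition H ^ k) χ S := by
  induction k generalizing S with
  | zero => exact hψ S subset_rfl
  | succ k ih =>
    have hS := hGH S subset_rfl
    rw [transition_pow_succ, transition_pow_succ]
    rcases (arcs G S).eq_empty_or_nonempty with h | h
    · rw [transition_of_arcs_eq_empty h, transition_of_arcs_eq_empty (hS ▸ h)]
      exact ih hGH hψ
    · rw [transition_of_nonempty h, transition_of_nonempty (hS ▸ h)]
      refine Finset.expect_congr hS fun e _ => ih ?_ ?_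
      · exact fun T hT => hGH T (hT.trans (Finset.erase_subset _ _))
      · exact fun T hT => hψ T (hT.trans (Finset.erase_subset _ _))

/- At most `S.card` joins are possible from `S`, so that the process has then ended. -/
theorem transition_pow_congr_of_card_le {ψ χ : Finset V → ℝ}
    (hψ : ∀ T, arcs G T = ∅ → ψ T = χ T) {k : ℕ} (hS : S.card ≤ k) :
    (transition G ^ k) ψ S = (transition G ^ k) χ S := by
  induction k generalizing S with
  | zero =>
    obtain rfl : S = ∅ := Finset.card_eq_zero.mp (Nat.le_zero.mp hS)
    exact hψ ∅ (arcs_empty G)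
  | succ k ih =>
    rcases (arcs G S).eq_empty_or_nonempty with h | h
    · rw [transition_pow_of_arcs_eq_empty h, transition_pow_of_arcs_eq_empty h, hψ S h]
    · rw [transition_pow_succ, transition_pow_succ, transition_of_nonempty h,
        transition_of_nonempty h]
      refine Finset.expect_congr rfl fun e he => ih ?_
      have := Finset.card_erase_add_one (mem_arcs.mp he).1
      omega

end Transition

section LastEdge

variable {V : Type*} [DecidableEq V] {G : SimpleGraph V} {S : Finset V} {e : V × V}

/-- The set of active vertices after the directed edge `e` has been offered to the joining process
in the state with active vertices `S`: the tail of `e` becomes passive if both ends are active. -/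
def offer (e : V × V) (S : Finset V) : Finset V :=
  if e.1 ∈ S ∧ e.2 ∈ S then S.erase e.1 else S

theorem transition_pow_deleteEdges_of_not_mem (he : ¬(e.1 ∈ S ∧ e.2 ∈ S)) (ψ : Finset V → ℝ)
    (k : ℕ) :
    (transition (G.deleteEdges {s(e.1, e.2)}) ^ k) (ψ ∘ offer e) S = (transition G ^ k) ψ S := by
  have he' : ∀ T ⊆ S, ¬(e.1 ∈ T ∧ e.2 ∈ T) := fun T hT h => he ⟨hT h.1, hT h.2⟩
  refine transition_pow_congr (fun T hT => ?_) (fun T hT => ?_) k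
  · have hsub : Disjoint (arcs G T) {e, e.swap} := by
      simp only [Finset.disjoint_insert_right, Finset.disjoint_singleton_right, swap_mem_arcs,
        and_self]
      exact fun h => he' T hT ⟨(mem_arcs.mp h).1, (mem_arcs.mp h).2.1⟩
    rw [arcs_deleteEdges, Finset.sdiff_eq_self_of_disjoint hsub]
  · rw [Function.comp_apply, offer, if_neg (he' T hT)]

theorem transition_pow_deleteEdges_of_card_eq_two (he : e ∈ arcs G S)
    (hcard : (arcs G S).card = 2) (ψ : Finset V → ℝ) (k : ℕ) :
    (transition (G.deleteEdges {s(e.1, e.2)}) ^ (k + 1)) (ψ ∘ offer e) S =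
      (transition G ^ k) ψ (S.erase e.1) := by
  have hdel : arcs (G.deleteEdges {s(e.1, e.2)}) S = ∅ := by
    have := card_arcs_deleteEdges he
    exact Finset.card_eq_zero.mp (by omega)
  have herase : arcs G (S.erase e.1) = ∅ := by
    rw [← Finset.subset_empty, ← hdel, arcs_deleteEdges]
    exact arcs_erase_subset G S e
  rw [transition_pow_of_arcs_eq_empty hdel, transition_pow_of_arcs_eq_empty herase,
    Function.comp_apply, offer, if_pos ⟨(mem_arcs.mp he).1, (mem_arcs.mp he).2.1⟩]

theorem sum_transition_pow_deleteEdges_of_arcs_subset {k : ℕ} {ψ : Finset V → ℝ}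
    {Q : Finset (V × V)} (hQ : arcs G S ⊆ Q) (hQG : ∀ e ∈ Q, G.Adj e.1 e.2)
    (h : ∑ e ∈ arcs G S, (transition (G.deleteEdges {s(e.1, e.2)}) ^ k) (ψ ∘ offer e) S =
      (arcs G S).card * (transition G ^ k) ψ S) :
    ∑ e ∈ Q, (transition (G.deleteEdges {s(e.1, e.2)}) ^ k) (ψ ∘ offer e) S =
      Q.card * (transition G ^ k) ψ S := by
  rw [← nsmul_eq_mul, ← Finset.sum_const, ← sub_eq_zero, ← Finset.sum_sub_distrib] at h ⊢
  rw [← Finset.sum_subset hQ, h]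
  refine fun e he he' => sub_eq_zero.mpr (transition_pow_deleteEdges_of_not_mem ?_ ψ k)
  exact fun h => he' (mem_arcs.mpr ⟨h.1, h.2, hQG e he⟩)

theorem sum_transition_pow_succ_deleteEdges {k : ℕ} {ψ : Finset V → ℝ}
    (ih : ∀ f ∈ arcs G S, ∑ e ∈ arcs G (S.erase f.1),
      (transition (G.deleteEdges {s(e.1, e.2)}) ^ k) (ψ ∘ offer e) (S.erase f.1) =
        (arcs G (S.erase f.1)).card * (transition G ^ k) ψ (S.erase f.1)) :
    ∑ e ∈ arcs G S, (transition (G.deleteEdges {s(e.1, e.2)}) ^ (k + 1)) (ψ ∘ offer e) S =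
      (arcs G S).card * (transition G ^ (k + 1)) ψ S := by
  rw [transition_pow_succ G, card_mul_transition]
  rcases (arcs G S).eq_empty_or_nonempty with h0 | ⟨e₀, he₀⟩
  · simp [h0]
  rcases (show 2 ≤ (arcs G S).card from
    (card_arcs_deleteEdges he₀).symm ▸ Nat.le_add_left 2 _).eq_or_lt' with h2 | h2
  · exact Finset.sum_congr rfl fun e he =>
      transition_pow_deleteEdges_of_card_eq_two he h2 ψ k
  have hcard : ∀ e ∈ arcs G S, ((arcs G S \ {e, e.swap}).card : ℝ) = (arcs G S).card - 2 := by
    intro e he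
    rw [← card_arcs_deleteEdges he, arcs_deleteEdges, Nat.cast_add, Nat.cast_ofNat,
      add_sub_cancel_right]
  have hM : ((arcs G S).card : ℝ) - 2 ≠ 0 := (sub_pos.mpr (by exact_mod_cast h2)).ne'
  refine mul_left_cancel₀ hM ?_
  rw [Finset.mul_sum, Finset.mul_sum]
  -- Count the pairs (edge processed last, edge processed first) in both orders.
  calc ∑ e ∈ arcs G S, ((arcs G S).card - 2 : ℝ) *
        (transition (G.deleteEdges {s(e.1, e.2)}) ^ (k + 1)) (ψ ∘ offer e) S
      = ∑ e ∈ arcs G S, ∑ f ∈ arcs G S \ {e, e.swap},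
          (transition (G.deleteEdges {s(e.1, e.2)}) ^ k) (ψ ∘ offer e) (S.erase f.1) := by
        refine Finset.sum_congr rfl fun e he => ?_
        rw [← hcard e he, ← arcs_deleteEdges, transition_pow_succ, card_mul_transition]
    _ = ∑ f ∈ arcs G S, ∑ e ∈ arcs G S \ {f, f.swap},
          (transition (G.deleteEdges {s(e.1, e.2)}) ^ k) (ψ ∘ offer e) (S.erase f.1) := by
        refine Finset.sum_comm' ?_
        rintro ⟨a, b⟩ ⟨c, d⟩
        simp only [Finset.mem_sdiff, Finset.mem_insert, Finset.mem_singleton, Prod.swap_prod_mk,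
          Prod.mk.injEq]
        tauto
    _ = ∑ f ∈ arcs G S, ((arcs G S).card - 2 : ℝ) * (transition G ^ k) ψ (S.erase f.1) := by
        refine Finset.sum_congr rfl fun f hf => ?_
        rw [← hcard f hf]
        refine sum_transition_pow_deleteEdges_of_arcs_subset (arcs_erase_subset G S f) ?_ (ih f hf)
        exact fun e he => (mem_arcs.mp (Finset.sdiff_subset he)).2.2

/- A uniformly random edge may be withheld and offered to the process last. -/
theorem sum_transition_pow_deleteEdges {k : ℕ} (hS : S.card ≤ k) (ψ : Finset V → ℝ) :
    ∑ e ∈ arcs G S, (transition (G.deleteEdges {s(e.1, e.2)}) ^ k) (ψ ∘ offer e) S =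
      (arcs G S).card * (transition G ^ k) ψ S := by
  induction k generalizing S with
  | zero =>
    obtain rfl : S = ∅ := Finset.card_eq_zero.mp (Nat.le_zero.mp hS)
    simp
  | succ k ih =>
    refine sum_transition_pow_succ_deleteEdges fun f hf => ih ?_
    rw [Finset.card_erase_of_mem (mem_arcs.mp hf).1]
    omega

end LastEdge

section AddEdge

variable {V : Type*} {G : SimpleGraph V} {a b : V}

theorem deleteEdges_sup_edge (h : G.Adj a b) :
    G.deleteEdges {s(a, b)} ⊔ SimpleGraph.edge a b = G := by
  rw [SimpleGraph.edge, SimpleGraph.deleteEdges, sdiff_sup_self, sup_eq_left,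
    SimpleGraph.fromEdgeSet_le]
  simp [h]

theorem sup_edge_deleteEdges (h : ¬G.Adj a b) :
    (G ⊔ SimpleGraph.edge a b).deleteEdges {s(a, b)} = G := by
  rw [SimpleGraph.edge, SimpleGraph.deleteEdges, sup_sdiff_right_self, sdiff_eq_left,
    SimpleGraph.disjoint_fromEdgeSet, Set.disjoint_singleton_right]
  exact h

end AddEdge

section DoubleCounting

variable {V : Type*} [Fintype V] {G : SimpleGraph V} {m : ℕ}

theorem card_arcs_univ (G : SimpleGraph V) [Fintype G.edgeSet] :
    (arcs G Finset.univ).card = 2 * G.edgeFinset.card := by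
  classical
  convert G.dart_card_eq_twice_card_edges
  rw [← Finset.card_univ,
    ← Finset.card_map ⟨SimpleGraph.Dart.toProd, SimpleGraph.Dart.toProd_injective⟩]
  congr 1
  ext e
  simp only [mem_arcs, Finset.mem_univ, true_and, Finset.mem_map, Function.Embedding.coeFn_mk]
  exact ⟨fun h => ⟨⟨e, h⟩, rfl⟩, fun ⟨d, hd⟩ => hd ▸ d.adj⟩

theorem mem_graphsWith : G ∈ graphsWith V m ↔ (arcs G Finset.univ).card = 2 * m := by
  classical
  rw [card_arcs_univ, Nat.mul_right_inj two_ne_zero]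
  simp [graphsWith]

theorem card_arcs_compl_add_card_arcs (G : SimpleGraph V) :
    (arcs Gᶜ Finset.univ).card + (arcs G Finset.univ).card = 2 * (Fintype.card V).choose 2 := by
  classical
  rw [card_arcs_univ, card_arcs_univ, ← mul_add,
    ← SimpleGraph.card_edgeFinset_top_eq_card_choose_two,
    ← Finset.card_union_of_disjoint (SimpleGraph.disjoint_edgeFinset.mpr disjoint_compl_left),
    ← SimpleGraph.edgeFinset_sup]
  congr! 3
  exact compl_sup_eq_top

theorem sum_graphsWith_succ (m : ℕ) (F : SimpleGraph V → V × V → ℝ) :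
    ∑ H ∈ graphsWith V (m + 1), ∑ e ∈ arcs H Finset.univ, F (H.deleteEdges {s(e.1, e.2)}) e =
      ∑ G ∈ graphsWith V m, ∑ e ∈ arcs Gᶜ Finset.univ, F G e := by
  rw [Finset.sum_sigma', Finset.sum_sigma']
  refine Finset.sum_bij' (fun x _ => ⟨x.1.deleteEdges {s(x.2.1, x.2.2)}, x.2⟩)
    (fun x _ => ⟨x.1 ⊔ SimpleGraph.edge x.2.1 x.2.2, x.2⟩) ?_ ?_ ?_ ?_ fun _ _ => rfl
  · rintro ⟨H, e⟩ hx
    simp only [Finset.mem_sigma, mem_graphsWith] at hx ⊢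
    have hadj := (mem_arcs.mp hx.2).2.2
    refine ⟨?_, by simp [mem_arcs, hadj.ne]⟩
    have := card_arcs_deleteEdges hx.2
    omega
  · rintro ⟨G, e⟩ hx
    simp only [Finset.mem_sigma, mem_graphsWith, mem_arcs, SimpleGraph.compl_adj] at hx ⊢
    obtain ⟨hG, -, -, hne, hadj⟩ := hx
    have he : e ∈ arcs (G ⊔ SimpleGraph.edge e.1 e.2) Finset.univ := by
      simp [mem_arcs, SimpleGraph.edge_adj, hne]
    have hcard := card_arcs_deleteEdges he
    rw [sup_edge_deleteEdges hadj] at hcard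
    exact ⟨by omega, mem_arcs.mp he⟩
  · rintro ⟨H, e⟩ hx
    rw [Finset.mem_sigma] at hx
    simp only [deleteEdges_sup_edge (mem_arcs.mp hx.2).2.2]
  · rintro ⟨G, e⟩ hx
    simp only [Finset.mem_sigma, mem_arcs, SimpleGraph.compl_adj] at hx
    simp only [sup_edge_deleteEdges hx.2.2.2.2]

section TotalValue

variable [DecidableEq V]

theorem sum_offer (hG : G ∈ graphsWith V m) {T : Finset V} (hT : arcs G T = ∅) (φ : ℕ → ℝ) :
    ∑ e ∈ arcs Gᶜ Finset.univ, φ (offer e T).card =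
      2 * ((Fintype.card V).choose 2 - m) * φ T.card -
        T.card * (T.card - 1) * (φ T.card - φ (T.card - 1)) := by
  have hoffer : ∀ e : V × V, φ (offer e T).card =
      φ T.card - if e.1 ∈ T ∧ e.2 ∈ T then φ T.card - φ (T.card - 1) else 0 := by
    intro e
    rw [offer]
    split_ifs with h
    · rw [Finset.card_erase_of_mem h.1, sub_sub_cancel]
    · rw [sub_zero]
  have hfilter : (arcs Gᶜ Finset.univ).filter (fun e => e.1 ∈ T ∧ e.2 ∈ T) = T.offDiag := by
    ext e
    have hadj : e.1 ∈ T → e.2 ∈ T → ¬G.Adj e.1 e.2 := fun h₁ h₂ h =>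
      Finset.eq_empty_iff_forall_notMem.mp hT e (mem_arcs.mpr ⟨h₁, h₂, h⟩)
    simp only [Finset.mem_filter, mem_arcs, SimpleGraph.compl_adj, Finset.mem_univ, true_and,
      Finset.mem_offDiag]
    tauto
  have hcompl : ((arcs Gᶜ Finset.univ).card : ℝ) = 2 * ((Fintype.card V).choose 2 - m) := by
    have h := card_arcs_compl_add_card_arcs G
    rw [mem_graphsWith.mp hG] at h
    rw [mul_sub, eq_sub_iff_add_eq]
    exact_mod_cast h
  rw [Finset.sum_congr rfl fun e _ => hoffer e, Finset.sum_sub_distrib, ← Finset.sum_filter,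
    hfilter, Finset.sum_const, Finset.sum_const, nsmul_eq_mul, nsmul_eq_mul, hcompl,
    Finset.offDiag_card, Nat.cast_sub (Nat.le_mul_self _), Nat.cast_mul, mul_sub_one]

/-- The sum over all graphs on `V` with `m` edges of the expectation of `φ` at the final number of
active vertices. -/
noncomputable def totalValue (V : Type*) [Fintype V] [DecidableEq V] (m : ℕ) (φ : ℕ → ℝ) : ℝ :=
  ∑ G ∈ graphsWith V m, (transition G ^ Fintype.card V) (fun T => φ T.card) Finset.univ

theorem totalValue_const (m : ℕ) (c : ℝ) :
    totalValue V m (fun _ => c) = (graphsWith V m).card * c := by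
  simp only [totalValue, transition_pow_const, Finset.sum_const, nsmul_eq_mul]

theorem totalValue_zero (φ : ℕ → ℝ) :
    totalValue V 0 φ = (graphsWith V 0).card * φ (Fintype.card V) := by
  rw [totalValue, ← nsmul_eq_mul, ← Finset.sum_const]
  refine Finset.sum_congr rfl fun G hG => ?_
  have h : arcs G Finset.univ = ∅ := Finset.card_eq_zero.mp (mem_graphsWith.mp hG)
  rw [transition_pow_of_arcs_eq_empty h, Finset.card_univ]

theorem totalValue_succ (m : ℕ) (φ : ℕ → ℝ) :
    2 * (m + 1) * totalValue V (m + 1) φ =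
      totalValue V m fun a =>
        2 * ((Fintype.card V).choose 2 - m) * φ a - a * (a - 1) * (φ a - φ (a - 1)) := by
  set ψ : Finset V → ℝ := fun T => φ T.card
  have hlast : ∀ H ∈ graphsWith V (m + 1), ∑ e ∈ arcs H Finset.univ,
      (transition (H.deleteEdges {s(e.1, e.2)}) ^ Fintype.card V) (ψ ∘ offer e) Finset.univ =
        2 * (m + 1) * (transition H ^ Fintype.card V) ψ Finset.univ := by
    intro H hH
    rw [sum_transition_pow_deleteEdges Finset.card_univ.le, mem_graphsWith.mp hH]
    push_cast
    rfl
  have hfirst : ∀ G ∈ graphsWith V m, ∑ e ∈ arcs Gᶜ Finset.univ,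
      (transition G ^ Fintype.card V) (ψ ∘ offer e) Finset.univ =
        (transition G ^ Fintype.card V) (fun T => 2 * ((Fintype.card V).choose 2 - m) * φ T.card -
          T.card * (T.card - 1) * (φ T.card - φ (T.card - 1))) Finset.univ := by
    intro G hG
    rw [← Finset.sum_apply, ← map_sum]
    refine transition_pow_congr_of_card_le (fun T hT => ?_) Finset.card_univ.le
    rw [Finset.sum_apply]
    exact sum_offer hG hT φ
  rw [totalValue, Finset.mul_sum, ← Finset.sum_congr rfl hlast, sum_graphsWith_succ m fun G e =>
    (transition G ^ Fintype.card V) (ψ ∘ offer e) Finset.univ]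
  exact Finset.sum_congr rfl hfirst

end TotalValue

theorem card_graphsWith_succ (m : ℕ) :
    ((m : ℝ) + 1) * (graphsWith V (m + 1)).card =
      ((Fintype.card V).choose 2 - m) * (graphsWith V m).card := by
  classical
  have h := totalValue_succ (V := V) m fun _ => 1
  simp only [sub_self, mul_zero, sub_zero, mul_one, totalValue_const] at h
  linarith

end DoubleCounting

section Mean

variable {α β : Type*}

/-- The expectation of `f` under the probability mass function `p`. It is only used on finite
types; unlike the Bochner integral it needs no measurable structure. -/
noncomputable def mean (p : PMF α) (f : α → ℝ) : ℝ :=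
  ∑' a, (p a).toReal * f a

theorem mean_pure (a : α) (f : α → ℝ) : mean (PMF.pure a) f = f a := by
  rw [mean, tsum_eq_single a fun b hb => by simp [hb]]
  simp

theorem mean_bind [Finite α] [Finite β] (p : PMF α) (q : α → PMF β) (f : β → ℝ) :
    mean (p.bind q) f = mean p fun a => mean (q a) f := by
  cases nonempty_fintype α
  cases nonempty_fintype β
  have hbind : ∀ b, (p.bind q b).toReal = ∑ a, (p a).toReal * (q a b).toReal := by
    intro b
    rw [PMF.bind_apply, tsum_fintype, ENNReal.toReal_sum]
    · simp only [ENNReal.toReal_mul]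
    · exact fun a _ => ENNReal.mul_ne_top (p.apply_ne_top _) ((q a).apply_ne_top _)
  simp only [mean, tsum_fintype, hbind, Finset.sum_mul, Finset.mul_sum]
  rw [Finset.sum_comm]
  simp only [mul_assoc]

theorem mean_map [Finite α] [Finite β] (p : PMF α) (g : α → β) (f : β → ℝ) :
    mean (p.map g) f = mean p (f ∘ g) := by
  rw [PMF.map, mean_bind]
  simp only [Function.comp_apply, mean_pure]
  rfl

theorem mean_uniformOfFinset (s : Finset α) (hs : s.Nonempty) (f : α → ℝ) :
    mean (PMF.uniformOfFinset s hs) f = 𝔼 a ∈ s, f a := by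
  rw [mean, tsum_eq_sum (s := s) fun a ha => by simp [ha], Finset.expect_eq_sum_div_card,
    Finset.sum_div]
  refine Finset.sum_congr rfl fun a ha => ?_
  rw [PMF.uniformOfFinset_apply_of_mem hs ha, ENNReal.toReal_inv, ENNReal.toReal_natCast,
    div_eq_inv_mul]

theorem integral_toMeasure_map [Finite α] (p : PMF α) (g : α → ℕ) (φ : ℕ → ℝ) :
    ∫ k, φ k ∂(p.map g).toMeasure = mean p (φ ∘ g) := by
  cases nonempty_fintype α
  let _ : MeasurableSpace α := ⊤
  rw [← PMF.toMeasure_map g p measurable_from_top, integral_map measurable_from_top.aemeasurable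
    (measurable_of_countable φ).aestronglyMeasurable, PMF.integral_eq_sum, mean, tsum_fintype]
  rfl

theorem integrable_toMeasure_map [Finite α] (p : PMF α) (g : α → ℕ) (φ : ℕ → ℝ) :
    Integrable φ (p.map g).toMeasure := by
  let _ : MeasurableSpace α := ⊤
  rw [← PMF.toMeasure_map g p measurable_from_top, integrable_map_measure
    (measurable_of_countable φ).aestronglyMeasurable measurable_from_top.aemeasurable]
  exact Integrable.of_finite

end Mean

section FinalState

variable {V : Type*} [Fintype V]

theorem activeEdges_eq_arcs (G : SimpleGraph V) (σ : State V) :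
    activeEdges G σ = arcs G (active σ) := by
  ext e
  simp only [activeEdges, Finset.mem_filter_univ, mem_arcs]
  tauto

theorem active_nonempty_of_mem_support_run [Nonempty V] {G : SimpleGraph V} {k : ℕ} {σ : State V}
    (hσ : σ ∈ (run G k).support) : (active σ).Nonempty := by
  classical
  induction k generalizing σ with
  | zero =>
    obtain rfl : σ = initial V := by simpa [run] using hσ
    simp [active, initial]
  | succ k ih =>
    obtain ⟨τ, hτ, hσ⟩ := (PMF.mem_support_bind_iff _ _ _).mp hσ
    unfold step at hσ
    split_ifs at hσ with h
    · obtain ⟨e, he, rfl⟩ := (PMF.mem_support_map_iff _ _ _).mp hσ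
      rw [PMF.mem_support_uniformOfFinset_iff, activeEdges_eq_arcs, mem_arcs] at he
      have hhead : τ e.2 = none := by simpa [active] using he.2.1
      exact ⟨e.2, by simp [active, Function.update_of_ne he.2.2.ne', hhead]⟩
    · obtain rfl : σ = τ := by simpa using hσ
      exact ih hτ

variable [DecidableEq V]

theorem active_update (σ : State V) (v u : V) :
    active (Function.update σ v (some u)) = (active σ).erase v := by
  ext w
  rcases eq_or_ne w v with rfl | hw
  · simp [active]
  · simp [active, hw]

theorem mean_step (G : SimpleGraph V) (ψ : Finset V → ℝ) (σ : State V) :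
    mean (step G σ) (ψ ∘ active) = transition G ψ (active σ) := by
  unfold step
  split_ifs with h
  · rw [mean_map, mean_uniformOfFinset, transition_of_nonempty (activeEdges_eq_arcs G σ ▸ h),
      activeEdges_eq_arcs]
    refine Finset.expect_congr rfl fun e _ => ?_
    rw [Function.comp_apply, Function.comp_apply, ← active_update σ e.1 e.2]
    congr!
  · rw [Finset.not_nonempty_iff_eq_empty, activeEdges_eq_arcs] at h
    rw [mean_pure, transition_of_arcs_eq_empty h, Function.comp_apply]

theorem mean_run (G : SimpleGraph V) (k : ℕ) (ψ : Finset V → ℝ) :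
    mean (run G k) (ψ ∘ active) = (transition G ^ k) ψ Finset.univ := by
  induction k generalizing ψ with
  | zero =>
    rw [run, mean_pure, Function.comp_apply, pow_zero, Module.End.one_apply]
    congr 1
    simp [active, initial]
  | succ k ih =>
    rw [run, mean_bind, pow_succ, Module.End.mul_apply, ← ih]
    simp only [mean_step]
    rfl

end FinalState

section ActiveLaw

variable {n m : ℕ}

theorem activeLaw_eq_map (hm : m ≤ n.choose 2) :
    activeLaw n m hm = ((gnm n m hm).bind final).map fun σ => (active σ).card := by
  rw [activeLaw, PMF.map_bind]

theorem integrable_activeLaw (hm : m ≤ n.choose 2) (φ : ℕ → ℝ) :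
    Integrable φ (activeLaw n m hm).toMeasure := by
  rw [activeLaw_eq_map]
  exact integrable_toMeasure_map _ _ φ

theorem integral_activeLaw (hm : m ≤ n.choose 2) (φ : ℕ → ℝ) :
    ∫ k, φ k ∂(activeLaw n m hm).toMeasure =
      totalValue (Fin n) m φ / (graphsWith (Fin n) m).card := by
  rw [activeLaw_eq_map, integral_toMeasure_map, mean_bind, gnm, mean_uniformOfFinset,
    Finset.expect_eq_sum_div_card, totalValue]
  congr! 2 with G
  exact mean_run G _ fun T => φ T.card

theorem ae_activeLaw_ne_zero (hm : m ≤ n.choose 2) (hn : n ≠ 0) :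
    ∀ᵐ k ∂(activeLaw n m hm).toMeasure, k ≠ 0 := by
  have : Nonempty (Fin n) := ⟨⟨0, Nat.pos_of_ne_zero hn⟩⟩
  rw [ae_iff, PMF.toMeasure_apply_eq_zero_iff _ .of_discrete, Set.disjoint_left]
  intro k hk hk0
  simp only [activeLaw, PMF.mem_support_bind_iff, PMF.mem_support_map_iff] at hk
  obtain ⟨G, -, σ, hσ, rfl⟩ := hk
  exact hk0 (active_nonempty_of_mem_support_run hσ).card_ne_zero

theorem integral_activeLaw_zero (n : ℕ) (φ : ℕ → ℝ) :
    ∫ k, φ k ∂(activeLaw n 0 (Nat.zero_le _)).toMeasure = φ n := by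
  have hcard : ((graphsWith (Fin n) 0).card : ℝ) ≠ 0 := by
    exact_mod_cast (graphsWith_nonempty (Nat.zero_le _)).card_ne_zero
  rw [integral_activeLaw, totalValue_zero, Fintype.card_fin, mul_div_cancel_left₀ _ hcard]

theorem integral_activeLaw_succ (hm : m + 1 ≤ n.choose 2) (φ : ℕ → ℝ) :
    ((n.choose 2 : ℝ) - m) * ∫ k, φ k ∂(activeLaw n (m + 1) hm).toMeasure =
      ((n.choose 2 : ℝ) - m) * ∫ k, φ k ∂(activeLaw n m (Nat.le_of_succ_le hm)).toMeasure -
        ∫ k, (k : ℝ) * (k - 1) / 2 * (φ k - φ (k - 1))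
          ∂(activeLaw n m (Nat.le_of_succ_le hm)).toMeasure := by
  have hcard : ∀ {m} (_ : m ≤ n.choose 2), ((graphsWith (Fin n) m).card : ℝ) ≠ 0 := fun h => by
    exact_mod_cast (graphsWith_nonempty h).card_ne_zero
  have h₀ := hcard (Nat.le_of_succ_le hm)
  have h₁ := hcard hm
  have htotal := totalValue_succ (V := Fin n) m φ
  have hratio := card_graphsWith_succ (V := Fin n) m
  rw [Fintype.card_fin] at htotal hratio
  calc ((n.choose 2 : ℝ) - m) * ∫ k, φ k ∂(activeLaw n (m + 1) hm).toMeasure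
      = ∫ k, (2 * ((n.choose 2 : ℝ) - m) * φ k - k * (k - 1) * (φ k - φ (k - 1))) / 2
          ∂(activeLaw n m (Nat.le_of_succ_le hm)).toMeasure := by
        rw [integral_div, integral_activeLaw, integral_activeLaw, ← htotal]
        field_simp
        linear_combination -totalValue (Fin n) (m + 1) φ * hratio
    _ = ∫ k, ((n.choose 2 : ℝ) - m) * φ k - (k : ℝ) * (k - 1) / 2 * (φ k - φ (k - 1))
          ∂(activeLaw n m (Nat.le_of_succ_le hm)).toMeasure := by
        congr 1 with k
        ring
    _ = _ := by
        rw [integral_sub (integrable_activeLaw _ _) (integrable_activeLaw _ _), integral_const_mul]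

theorem expectedActive_zero (n : ℕ) : expectedActive n 0 (Nat.zero_le _) = n :=
  integral_activeLaw_zero n fun k => (k : ℝ)

theorem expectedActive_succ (hm : m + 1 ≤ n.choose 2) :
    ((n.choose 2 : ℝ) - m) * expectedActive n (m + 1) hm =
      ((n.choose 2 : ℝ) - m) * expectedActive n m (Nat.le_of_succ_le hm) -
        ∫ k : ℕ, (k : ℝ) * (k - 1) / 2 ∂(activeLaw n m (Nat.le_of_succ_le hm)).toMeasure := by
  rw [expectedActive, integral_activeLaw_succ, ← expectedActive]
  congr 3 with k
  cases k <;> simp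

end ActiveLaw

section HarmonicMean

variable {Ω : Type*} [MeasurableSpace Ω] {P : Measure Ω} [IsProbabilityMeasure P] {X : Ω → ℝ}
  {B δ : ℝ}

theorem sq_sub_div_mul {x : ℝ} (hx : x ≠ 0) (hB : B ≠ 0) :
    (x - B) ^ 2 / (B * x) = x / B + B * x⁻¹ - 2 := by
  field_simp
  ring

theorem integrable_sq_sub_div_mul (hne : ∀ ω, X ω ≠ 0) (hX : Integrable X P)
    (hXinv : Integrable (fun ω => (X ω)⁻¹) P) (hB : B ≠ 0) :
    Integrable (fun ω => (X ω - B) ^ 2 / (B * X ω)) P := by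
  simp only [sq_sub_div_mul (hne _) hB]
  exact ((hX.div_const B).add (hXinv.const_mul B)).sub (integrable_const 2)

theorem integral_sq_sub_div_mul (hne : ∀ ω, X ω ≠ 0) (hX : Integrable X P)
    (hXinv : Integrable (fun ω => (X ω)⁻¹) P) (hB : B ≠ 0) (hmean : ∫ ω, (X ω)⁻¹ ∂P = B⁻¹) :
    ∫ ω, (X ω - B) ^ 2 / (B * X ω) ∂P = (∫ ω, X ω ∂P) / B - 1 := by
  have hsum : Integrable (fun ω => X ω / B + B * (X ω)⁻¹) P :=
    (hX.div_const B).add (hXinv.const_mul B)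
  simp only [sq_sub_div_mul (hne _) hB]
  rw [integral_sub hsum (integrable_const 2),
    integral_add (hX.div_const B) (hXinv.const_mul B), integral_div, integral_const_mul, hmean,
    mul_inv_cancel₀ hB, integral_const, probReal_univ, one_smul]
  ring

theorem le_integral_of_integral_inv_eq (hpos : ∀ ω, 0 < X ω) (hX : Integrable X P)
    (hXinv : Integrable (fun ω => (X ω)⁻¹) P) (hB : 0 < B) (hmean : ∫ ω, (X ω)⁻¹ ∂P = B⁻¹) :
    B ≤ ∫ ω, X ω ∂P := by
  have hdev : 0 ≤ (∫ ω, X ω ∂P) / B - 1 := by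
    rw [← integral_sq_sub_div_mul (fun ω => (hpos ω).ne') hX hXinv hB.ne' hmean]
    refine integral_nonneg fun ω => ?_
    have := hpos ω
    positivity
  rwa [sub_nonneg, one_le_div hB] at hdev

theorem le_sq_sub_div_mul_of_le_abs_sub {y : ℝ} (hδ : 0 < δ) (hB : 0 < B) (hy : 0 < y)
    (h : δ * B ≤ |y - B|) : δ ^ 2 / (1 + δ) ≤ (y - B) ^ 2 / (B * y) := by
  have hyB : y ≤ B + |y - B| := by linarith [le_abs_self (y - B)]
  rw [← sq_abs (y - B)]
  set t := |y - B|
  have ht : 0 < t := (mul_pos hδ hB).trans_le h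
  calc δ ^ 2 / (1 + δ) ≤ t ^ 2 / (B * (B + t)) := by
        rw [div_le_div_iff₀ (by positivity) (by positivity)]
        have : 0 ≤ (t - δ * B) * (t + δ * B + δ * t) :=
          mul_nonneg (sub_nonneg.mpr h) (by positivity)
        linarith
    _ ≤ t ^ 2 / (B * y) := by gcongr

theorem measureReal_le_abs_sub_le (hpos : ∀ ω, 0 < X ω) (hX : Integrable X P)
    (hXinv : Integrable (fun ω => (X ω)⁻¹) P) (hB : 0 < B) (hmean : ∫ ω, (X ω)⁻¹ ∂P = B⁻¹)
    (hδ : 0 < δ) :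
    P.real {ω | δ * B ≤ |X ω - B|} ≤ (1 + δ) / δ ^ 2 * ((∫ ω, X ω ∂P) / B - 1) := by
  have hmarkov := mul_meas_ge_le_integral_of_nonneg
    (Eventually.of_forall fun ω => show 0 ≤ (X ω - B) ^ 2 / (B * X ω) by
      have := hpos ω
      positivity)
    (integrable_sq_sub_div_mul (fun ω => (hpos ω).ne') hX hXinv hB.ne') (δ ^ 2 / (1 + δ))
  rw [integral_sq_sub_div_mul (fun ω => (hpos ω).ne') hX hXinv hB.ne' hmean] at hmarkov
  rw [← inv_div (δ ^ 2), ← div_eq_inv_mul, le_div_iff₀' (by positivity)]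
  refine (mul_le_mul_of_nonneg_left (measureReal_mono fun ω hω => ?_) (by positivity)).trans hmarkov
  exact le_sq_sub_div_mul_of_le_abs_sub hδ hB (hpos ω) hω

end HarmonicMean

section FragmentCount

variable {n m : ℕ}

/-- The harmonic mean of `a(m) + 1`, see `integral_inv_activeLaw`. -/
noncomputable def harmonicMean (n m : ℕ) : ℝ :=
  n * (n + 1) / (n + m)

theorem harmonicMean_pos (hn : n ≠ 0) : 0 < harmonicMean n m := by
  unfold harmonicMean
  positivity

theorem integral_inv_activeLaw (hm : m ≤ n.choose 2) (hn : n ≠ 0) :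
    ∫ k : ℕ, ((k : ℝ) + 1)⁻¹ ∂(activeLaw n m hm).toMeasure = (harmonicMean n m)⁻¹ := by
  rw [harmonicMean, inv_div]
  induction m with
  | zero =>
    rw [integral_activeLaw_zero n fun k => ((k : ℝ) + 1)⁻¹]
    push_cast
    field_simp
    ring
  | succ m ih =>
    have hL : ((n.choose 2 : ℝ) - m) ≠ 0 :=
      (sub_pos.mpr (by exact_mod_cast Nat.lt_of_succ_le hm)).ne'
    have hloss : ∀ k : ℕ, k ≠ 0 → (k : ℝ) * (k - 1) / 2 *
        (((k : ℝ) + 1)⁻¹ - (((k - 1 : ℕ) : ℝ) + 1)⁻¹) = ((k : ℝ) + 1)⁻¹ - 1 / 2 := by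
      intro k hk
      rw [Nat.cast_pred (Nat.pos_of_ne_zero hk), sub_add_cancel]
      field_simp
      ring
    refine mul_left_cancel₀ hL ?_
    rw [integral_activeLaw_succ hm fun k => ((k : ℝ) + 1)⁻¹, integral_congr_ae
      ((ae_activeLaw_ne_zero (Nat.le_of_succ_le hm) hn).mono hloss),
      integral_sub (integrable_activeLaw _ _) (integrable_activeLaw _ _), ih,
      integral_const, probReal_univ, one_smul, Nat.cast_choose_two]
    push_cast
    field_simp
    ring

theorem integral_succ_activeLaw (hm : m ≤ n.choose 2) :
    ∫ k : ℕ, ((k : ℝ) + 1) ∂(activeLaw n m hm).toMeasure = expectedActive n m hm + 1 := by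
  rw [integral_add (integrable_activeLaw _ _) (integrable_activeLaw _ _), integral_const,
    probReal_univ, one_smul, expectedActive]

theorem harmonicMean_sub_one_le_expectedActive (hm : m ≤ n.choose 2) (hn : n ≠ 0) :
    harmonicMean n m - 1 ≤ expectedActive n m hm := by
  rw [sub_le_iff_le_add, ← integral_succ_activeLaw]
  exact le_integral_of_integral_inv_eq (fun k => by positivity) (integrable_activeLaw _ _)
    (integrable_activeLaw _ _) (harmonicMean_pos hn) (integral_inv_activeLaw hm hn)

theorem half_mul_le_abs_add_one_sub {x y B ε : ℝ} (hε : 0 < ε) (hlow : B - 1 ≤ y) (hup : y ≤ B)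
    (hlarge : 2 * (1 + ε) / ε ≤ B) (h : ε * y ≤ |x - y|) : ε / 2 * B ≤ |x + 1 - B| := by
  have hshift : |x - y| ≤ |x + 1 - B| + 1 :=
    calc |x - y| = |(x + 1 - B) + (B - 1 - y)| := by ring_nf
      _ ≤ |x + 1 - B| + |B - 1 - y| := abs_add_le _ _
      _ ≤ |x + 1 - B| + 1 := by
        gcongr
        exact abs_le.mpr ⟨by linarith, by linarith⟩
  have hy : ε * (B - 1) ≤ ε * y := by gcongr
  rw [div_le_iff₀ hε] at hlarge
  linarith

theorem measureReal_deviation_le (hm : m ≤ n.choose 2) (hn : n ≠ 0) {ε : ℝ} (hε : 0 < ε)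
    (hmean : expectedActive n m hm ≤ harmonicMean n m)
    (hlarge : 2 * (1 + ε) / ε ≤ harmonicMean n m) :
    (activeLaw n m hm).toMeasure.real
      {k : ℕ | ε * expectedActive n m hm ≤ |(k : ℝ) - expectedActive n m hm|} ≤
      (1 + ε / 2) / (ε / 2) ^ 2 * (harmonicMean n m)⁻¹ := by
  have hB := harmonicMean_pos (m := m) hn
  have hlow := harmonicMean_sub_one_le_expectedActive hm hn
  set B := harmonicMean n m
  set μ := expectedActive n m hm
  have hsub : {k : ℕ | ε * μ ≤ |(k : ℝ) - μ|} ⊆ {k : ℕ | ε / 2 * B ≤ |(k : ℝ) + 1 - B|} :=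
    fun _ hk => half_mul_le_abs_add_one_sub hε hlow hmean hlarge hk
  calc (activeLaw n m hm).toMeasure.real {k : ℕ | ε * μ ≤ |(k : ℝ) - μ|}
      ≤ (activeLaw n m hm).toMeasure.real {k : ℕ | ε / 2 * B ≤ |(k : ℝ) + 1 - B|} :=
        measureReal_mono hsub
    _ ≤ (1 + ε / 2) / (ε / 2) ^ 2 *
          ((∫ k : ℕ, ((k : ℝ) + 1) ∂(activeLaw n m hm).toMeasure) / B - 1) :=
        measureReal_le_abs_sub_le (fun k => by positivity) (integrable_activeLaw _ _)
          (integrable_activeLaw _ _) hB (integral_inv_activeLaw hm hn) (by positivity)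
    _ ≤ (1 + ε / 2) / (ε / 2) ^ 2 * B⁻¹ := by
        gcongr
        rw [integral_succ_activeLaw, add_div, one_div, add_sub_right_comm, add_le_iff_nonpos_left,
          sub_nonpos]
        exact (div_le_one hB).mpr hmean

end FragmentCount

section MeanFieldRatio

variable {n m : ℕ}

/-- The quantity `r` for which the mean field is `1 / (1 - r)`. -/
noncomputable def meanFieldRatio (n m : ℕ) : ℝ :=
  (1 - 1 / (n : ℝ)) * √(1 - m / n.choose 2)

theorem meanField_eq (n m : ℕ) : meanField n m = (1 - meanFieldRatio n m)⁻¹ :=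
  one_div _

theorem one_sub_one_div_nonneg (n : ℕ) : 0 ≤ 1 - 1 / (n : ℝ) :=
  sub_nonneg.mpr (by simpa using Nat.cast_inv_le_one n)

theorem meanFieldRatio_nonneg (n m : ℕ) : 0 ≤ meanFieldRatio n m :=
  mul_nonneg (one_sub_one_div_nonneg n) (Real.sqrt_nonneg _)

theorem meanFieldRatio_le (n m : ℕ) : meanFieldRatio n m ≤ 1 - 1 / n := by
  refine mul_le_of_le_one_right (one_sub_one_div_nonneg n) ?_
  rw [Real.sqrt_le_one, sub_le_self_iff]
  positivity

theorem meanFieldRatio_lt_one (m : ℕ) (hn : n ≠ 0) : meanFieldRatio n m < 1 :=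
  (meanFieldRatio_le n m).trans_lt (sub_lt_self 1 (by positivity))

theorem cube_mul_meanFieldRatio_sq (hm : m ≤ n.choose 2) (hn : 2 ≤ n) :
    (n : ℝ) ^ 3 * meanFieldRatio n m ^ 2 = 2 * (n - 1) * (n.choose 2 - m) := by
  have hn₁ : (n : ℝ) - 1 ≠ 0 := (sub_pos.mpr (by exact_mod_cast hn)).ne'
  have hx : (m : ℝ) / n.choose 2 ≤ 1 := div_le_one_of_le₀ (by exact_mod_cast hm) (by positivity)
  rw [meanFieldRatio, mul_pow, Real.sq_sqrt (sub_nonneg.mpr hx), Nat.cast_choose_two]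
  field_simp

theorem meanFieldRatio_sq_sub (hm : m + 1 ≤ n.choose 2) (hn : 2 ≤ n) :
    ((n.choose 2 : ℝ) - m) * (meanFieldRatio n m ^ 2 - meanFieldRatio n (m + 1) ^ 2) =
      meanFieldRatio n m ^ 2 := by
  have h₀ := cube_mul_meanFieldRatio_sq (Nat.le_of_succ_le hm) hn
  have h₁ := cube_mul_meanFieldRatio_sq hm hn
  have hn₀ : (n : ℝ) ^ 3 ≠ 0 := by positivity
  refine mul_left_cancel₀ hn₀ ?_
  push_cast at h₁
  linear_combination (n.choose 2 - m - 1 : ℝ) * h₀ - (n.choose 2 - m : ℝ) * h₁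

theorem meanFieldRatio_pos (hm : m < n.choose 2) (hn : 2 ≤ n) : 0 < meanFieldRatio n m := by
  have hn₁ : (0 : ℝ) < n - 1 := sub_pos.mpr (by exact_mod_cast hn)
  have hL : (0 : ℝ) < n.choose 2 - m := sub_pos.mpr (by exact_mod_cast hm)
  have hcube : 0 < (n : ℝ) ^ 3 * meanFieldRatio n m ^ 2 := by
    rw [cube_mul_meanFieldRatio_sq hm.le hn]
    positivity
  exact (meanFieldRatio_nonneg n m).lt_of_ne' fun h => by simp [h] at hcube

theorem meanFieldRatio_succ_le (hm : m + 1 ≤ n.choose 2) (hn : 2 ≤ n) :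
    meanFieldRatio n (m + 1) ≤ meanFieldRatio n m := by
  have hL : (0 : ℝ) ≤ n.choose 2 - m := sub_nonneg.mpr (by exact_mod_cast Nat.le_of_succ_le hm)
  refine le_of_sq_le_sq (sub_nonneg.mp (pos_of_mul_pos_right ?_ hL).le) (meanFieldRatio_nonneg n m)
  rw [meanFieldRatio_sq_sub hm hn]
  exact pow_pos (meanFieldRatio_pos hm hn) 2

end MeanFieldRatio

section MeanFieldStep

variable {L r s : ℝ}

theorem inv_one_sub_step_of_le_half (hL : 0 ≤ L) (hr : 0 < r) (hr₂ : r ≤ 1 / 2) (hs : 0 ≤ s)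
    (hsr : s ≤ r) (h : L * (r ^ 2 - s ^ 2) = r ^ 2) :
    L * (1 - r)⁻¹ - ((1 - r)⁻¹ - 1) ≤ L * (1 - s)⁻¹ := by
  have hr₁ : 0 < 1 - r := by linarith
  have hs₁ : 0 < 1 - s := by linarith
  have hgap : L * (1 - s)⁻¹ - (L * (1 - r)⁻¹ - ((1 - r)⁻¹ - 1)) =
      L * s * (r - s) * (1 - (r + s)) / (r * (1 - r) * (1 - s)) := by
    field_simp
    linear_combination (s - 1) * h
  rw [← sub_nonneg, hgap]
  have : 0 ≤ r - s := sub_nonneg.mpr hsr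
  have : 0 ≤ 1 - (r + s) := by linarith
  exact div_nonneg (by positivity) (mul_pos (mul_pos hr hr₁) hs₁).le

theorem inv_one_sub_step_of_half_le (hL : 0 ≤ L) (hr₂ : 1 / 2 ≤ r) (hr₁ : r < 1) (hs : 0 ≤ s)
    (hsr : s ≤ r) (h : L * (r ^ 2 - s ^ 2) = r ^ 2) :
    L * (1 - r)⁻¹ - (1 - r)⁻¹ * ((1 - r)⁻¹ - 1) / 2 ≤ L * (1 - s)⁻¹ := by
  have : 0 < r := by linarith
  have hr₁' : 0 < 1 - r := by linarith
  have hs₁ : 0 < 1 - s := by linarith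
  have hgap : L * (1 - s)⁻¹ - (L * (1 - r)⁻¹ - (1 - r)⁻¹ * ((1 - r)⁻¹ - 1) / 2) =
      L * (r - s) ^ 2 * (2 * r + s - 1) / (2 * r * (1 - r) ^ 2 * (1 - s)) := by
    field_simp
    linear_combination (s - 1) * h
  rw [← sub_nonneg, hgap]
  have : 0 ≤ 2 * r + s - 1 := by linarith
  positivity

theorem one_add_mul_le_cube_mul {n r : ℝ} (hn : 3 ≤ n) (hr₂ : 1 / 2 ≤ r) (hr : r ≤ 1 - 1 / n) :
    (1 + r) * (n - 1) ≤ n ^ 3 * r ^ 2 * (1 - r) := by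
  have hinv : 1 / n ≤ 1 / 2 := by
    gcongr
    linarith
  have hr₁ : n - 1 ≤ n ^ 2 * (r * (1 - r)) :=
    calc n - 1 = n ^ 2 * (1 / n * (1 - 1 / n)) := by
          field_simp
      _ ≤ n ^ 2 * (r * (1 - r)) := by
          gcongr ?_ * ?_
          have := mul_nonneg (sub_nonneg.mpr (hinv.trans hr₂)) (sub_nonneg.mpr hr)
          linarith
  calc (1 + r) * (n - 1) ≤ n * r * (n - 1) := by
        gcongr
        · linarith
        · nlinarith
    _ ≤ n * r * (n ^ 2 * (r * (1 - r))) := by gcongr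
    _ = n ^ 3 * r ^ 2 * (1 - r) := by ring

theorem inv_one_sub_sub_half_le {n : ℕ} (hn : n ≠ 0) (hr₂ : 1 / 2 < r) (hr : r ≤ 1 - 1 / n)
    (h : (n : ℝ) ^ 3 * r ^ 2 = 2 * (n - 1) * L) : (1 - r)⁻¹ - 1 / 2 ≤ L := by
  have hn₀ : (0 : ℝ) < n := by positivity
  have hn₃ : (3 : ℝ) ≤ n := by
    have : (2 : ℝ) < n := lt_of_one_div_lt_one_div hn₀ (by linarith)
    exact_mod_cast this
  have hr₁ : 0 < 1 - r := (one_div_pos.mpr hn₀).trans_le (by linarith)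
  have hcube := one_add_mul_le_cube_mul hn₃ hr₂.le hr
  rw [h] at hcube
  have hfrac : (1 - r)⁻¹ - 1 / 2 = (1 + r) / (2 * (1 - r)) := by
    field_simp
    ring
  rw [hfrac, div_le_iff₀ (by positivity)]
  refine le_of_mul_le_mul_right ?_ (show (0 : ℝ) < n - 1 by linarith)
  linarith

end MeanFieldStep

section UpperBound

variable {Ω : Type*} [MeasurableSpace Ω] {P : Measure Ω} [IsProbabilityMeasure P] {X Y : Ω → ℝ}

/- Jensen's inequality, for a minorant of `Y` by an affine function of `X`. -/
theorem mul_integral_sub_integral_le {L b c f : ℝ} (hX : Integrable X P) (hY : Integrable Y P)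
    (hline : ∀ ω, b + c * (X ω - f) ≤ Y ω) (hc : c ≤ L) (hf : ∫ ω, X ω ∂P ≤ f) :
    L * ∫ ω, X ω ∂P - ∫ ω, Y ω ∂P ≤ L * f - b := by
  have hdiff : Integrable (fun ω => c * (X ω - f)) P := (hX.sub (integrable_const f)).const_mul c
  have haffine : Integrable (fun ω => b + c * (X ω - f)) P := (integrable_const b).add hdiff
  have hint : b + c * (∫ ω, X ω ∂P - f) ≤ ∫ ω, Y ω ∂P :=
    calc b + c * (∫ ω, X ω ∂P - f) = ∫ ω, (b + c * (X ω - f)) ∂P := by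
          rw [integral_add (integrable_const b) hdiff, integral_const_mul,
            integral_sub hX (integrable_const f)]
          simp only [integral_const, probReal_univ, one_smul]
      _ ≤ ∫ ω, Y ω ∂P := integral_mono haffine hY hline
  linarith [mul_nonneg (sub_nonneg.mpr hc) (sub_nonneg.mpr hf)]

variable {n m : ℕ}

theorem mul_expectedActive_succ_le (hm : m + 1 ≤ n.choose 2) {b c f : ℝ}
    (hline : ∀ k : ℕ, b + c * (k - f) ≤ (k : ℝ) * (k - 1) / 2) (hc : c ≤ n.choose 2 - m)
    (hf : expectedActive n m (Nat.le_of_succ_le hm) ≤ f) :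
    ((n.choose 2 : ℝ) - m) * expectedActive n (m + 1) hm ≤ ((n.choose 2 : ℝ) - m) * f - b := by
  rw [expectedActive_succ]
  exact mul_integral_sub_integral_le (integrable_activeLaw _ _) (integrable_activeLaw _ _) hline hc
    hf

theorem sub_one_mul_sub_two_nonneg (k : ℕ) : 0 ≤ ((k : ℝ) - 1) * (k - 2) := by
  rcases k with _ | _ | k
  · norm_num
  · norm_num
  · push_cast
    ring_nf
    positivity

theorem expectedActive_le_meanField (hm : m ≤ n.choose 2) (hn : 2 ≤ n) :
    expectedActive n m hm ≤ meanField n m := by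
  induction m with
  | zero => simp [expectedActive_zero, meanField]
  | succ m ih =>
    have hL : (1 : ℝ) ≤ n.choose 2 - m := by
      rw [le_sub_iff_add_le']
      exact_mod_cast hm
    have hn₀ : n ≠ 0 := by omega
    have ih := ih (Nat.le_of_succ_le hm)
    have hsq := meanFieldRatio_sq_sub hm hn
    have hcube := cube_mul_meanFieldRatio_sq (Nat.le_of_succ_le hm) hn
    have hs := meanFieldRatio_nonneg n (m + 1)
    have hsr := meanFieldRatio_succ_le hm hn
    rw [meanField_eq] at ih ⊢
    refine le_of_mul_le_mul_left ?_ (zero_lt_one.trans_le hL)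
    /- Minorize `k (k - 1) / 2` by its secant through `k = 1, 2` if the mean field is at most `2`,
    and by its tangent at the mean field otherwise. -/
    rcases le_or_gt (meanFieldRatio n m) (1 / 2) with hr₂ | hr₂
    · refine (mul_expectedActive_succ_le hm (fun k => ?_) hL ih).trans
        (inv_one_sub_step_of_le_half (zero_le_one.trans hL) (meanFieldRatio_pos hm hn) hr₂ hs hsr
          hsq)
      have hk := sub_one_mul_sub_two_nonneg k
      linarith
    · refine (mul_expectedActive_succ_le hm (fun k => ?_)
        (inv_one_sub_sub_half_le hn₀ hr₂ (meanFieldRatio_le n m) hcube) ih).trans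
        (inv_one_sub_step_of_half_le (zero_le_one.trans hL) hr₂.le (meanFieldRatio_lt_one m hn₀) hs
          hsr hsq)
      linarith [sq_nonneg ((k : ℝ) - (1 - meanFieldRatio n m)⁻¹)]

theorem meanField_le (hm : m ≤ n.choose 2) (hn : 2 ≤ n) :
    meanField n m ≤ (n : ℝ) ^ 2 / (n + m) := by
  have hn₁ : (n : ℝ) - 1 ≠ 0 := (sub_pos.mpr (by exact_mod_cast hn)).ne'
  have hx : (m : ℝ) / n.choose 2 ≤ 1 := div_le_one_of_le₀ (by exact_mod_cast hm) (by positivity)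
  have hsqrt : √(1 - (m : ℝ) / n.choose 2) ≤ 1 - m / n.choose 2 / 2 := by
    refine Real.sqrt_le_iff.mpr ⟨by linarith, ?_⟩
    linarith [sq_nonneg ((m : ℝ) / n.choose 2 / 2)]
  rw [meanField_eq, ← inv_div]
  refine inv_anti₀ (by positivity) ?_
  calc ((n : ℝ) + m) / n ^ 2 = 1 - (1 - 1 / (n : ℝ)) * (1 - m / n.choose 2 / 2) := by
        rw [Nat.cast_choose_two]
        field_simp
        ring
    _ ≤ 1 - meanFieldRatio n m :=
        sub_le_sub_left (mul_le_mul_of_nonneg_left hsqrt (one_sub_one_div_nonneg n)) 1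

end UpperBound

section Asymptotics

theorem expectedActive_le {n m : ℕ} (hm : m ≤ n.choose 2) (hn : 2 ≤ n) :
    expectedActive n m hm ≤ (n : ℝ) ^ 2 / (n + m) :=
  (expectedActive_le_meanField hm hn).trans (meanField_le hm hn)

theorem sq_div_le_harmonicMean (n m : ℕ) : (n : ℝ) ^ 2 / (n + m) ≤ harmonicMean n m := by
  rw [harmonicMean, sq]
  gcongr
  exact le_add_of_nonneg_right zero_le_one

variable {m : ℕ → ℕ}

theorem tendsto_div_sq_zero {ω : ℕ → ℝ} (hω : Tendsto ω atTop atTop)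
    (hmω : ∀ᶠ n in atTop, (m n : ℝ) ≤ (n.choose 2 : ℝ) / ω n) :
    Tendsto (fun n => (m n : ℝ) / (n : ℝ) ^ 2) atTop (𝓝 0) := by
  refine squeeze_zero' (Eventually.of_forall fun n => by positivity) ?_
    (tendsto_inv_atTop_zero.comp hω)
  filter_upwards [hmω, hω.eventually_gt_atTop 0] with n hmn hωn
  have hchoose : (n.choose 2 : ℝ) ≤ (n : ℝ) ^ 2 := by exact_mod_cast Nat.choose_le_pow n 2
  calc (m n : ℝ) / (n : ℝ) ^ 2 ≤ (n : ℝ) ^ 2 / ω n / (n : ℝ) ^ 2 := by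
        gcongr
        exact hmn.trans (by gcongr)
    _ = (n : ℝ) ^ 2 / (n : ℝ) ^ 2 * (ω n)⁻¹ := by ring
    _ ≤ (ω n)⁻¹ := mul_le_of_le_one_left (by positivity) (div_self_le_one _)

theorem tendsto_inv_harmonicMean (hm : Tendsto (fun n => (m n : ℝ) / (n : ℝ) ^ 2) atTop (𝓝 0)) :
    Tendsto (fun n => (harmonicMean n (m n))⁻¹) atTop (𝓝 0) := by
  have hsum : Tendsto (fun n : ℕ => 1 / (n : ℝ) + (m n : ℝ) / (n : ℝ) ^ 2) atTop (𝓝 0) := by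
    simpa only [add_zero] using tendsto_one_div_atTop_nhds_zero_nat.add hm
  refine squeeze_zero' (Eventually.of_forall fun n => ?_) ?_ hsum
  · unfold harmonicMean
    positivity
  filter_upwards [eventually_ne_atTop 0] with n hn
  calc (harmonicMean n (m n))⁻¹ ≤ ((n : ℝ) ^ 2 / (n + m n))⁻¹ :=
        inv_anti₀ (by positivity) (sq_div_le_harmonicMean n (m n))
    _ = 1 / (n : ℝ) + (m n : ℝ) / (n : ℝ) ^ 2 := by
        field_simp

theorem isEquivalent_sq_div {u : ℕ → ℝ}
    (hm : Tendsto (fun n => (m n : ℝ) / (n : ℝ) ^ 2) atTop (𝓝 0))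
    (hlow : ∀ᶠ n in atTop, harmonicMean n (m n) - 1 ≤ u n)
    (hup : ∀ᶠ n in atTop, u n ≤ (n : ℝ) ^ 2 / (n + m n)) :
    u ~[atTop] fun n => (n : ℝ) ^ 2 / ((n : ℝ) + (m n : ℝ)) := by
  refine isEquivalent_of_tendsto_one ?_
  have hlim : Tendsto (fun n => 1 - (m n : ℝ) / (n : ℝ) ^ 2) atTop (𝓝 1) := by
    simpa only [sub_zero] using hm.const_sub 1
  refine tendsto_of_tendsto_of_tendsto_of_le_of_le' hlim tendsto_const_nhds ?_ ?_
  · filter_upwards [hlow, eventually_ne_atTop 0] with n hn hn₀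
    rw [Pi.div_apply, le_div_iff₀ (by positivity)]
    refine le_of_eq_of_le ?_ hn
    rw [harmonicMean]
    field_simp
    ring
  · filter_upwards [hup] with n hn
    exact div_le_one_of_le₀ hn (by positivity)

theorem isEquivalent_expectedActive (hm : ∀ n, m n ≤ n.choose 2)
    (hlim : Tendsto (fun n => (m n : ℝ) / (n : ℝ) ^ 2) atTop (𝓝 0)) :
    (fun n => expectedActive n (m n) (hm n)) ~[atTop]
      fun n => (n : ℝ) ^ 2 / ((n : ℝ) + (m n : ℝ)) :=
  isEquivalent_sq_div hlim
    ((eventually_ne_atTop 0).mono fun n hn => harmonicMean_sub_one_le_expectedActive (hm n) hn)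
    ((eventually_ge_atTop 2).mono fun n hn => expectedActive_le (hm n) hn)

theorem isEquivalent_meanField (hm : ∀ n, m n ≤ n.choose 2)
    (hlim : Tendsto (fun n => (m n : ℝ) / (n : ℝ) ^ 2) atTop (𝓝 0)) :
    (fun n => meanField n (m n)) ~[atTop] fun n => (n : ℝ) ^ 2 / ((n : ℝ) + (m n : ℝ)) :=
  isEquivalent_sq_div hlim
    ((eventually_ge_atTop 2).mono fun n hn =>
      (harmonicMean_sub_one_le_expectedActive (hm n) (by omega)).trans
        (expectedActive_le_meanField (hm n) hn))
    ((eventually_ge_atTop 2).mono fun n hn => meanField_le (hm n) hn)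

theorem tendsto_measure_deviation (hm : ∀ n, m n ≤ n.choose 2)
    (hlim : Tendsto (fun n => (m n : ℝ) / (n : ℝ) ^ 2) atTop (𝓝 0)) {ε : ℝ} (hε : 0 < ε) :
    Tendsto (fun n => (activeLaw n (m n) (hm n)).toMeasure
      {k : ℕ | ε * expectedActive n (m n) (hm n) ≤ |(k : ℝ) - expectedActive n (m n) (hm n)|})
      atTop (𝓝 0) := by
  have hinv := tendsto_inv_harmonicMean hlim
  have hbound := hinv.const_mul ((1 + ε / 2) / (ε / 2) ^ 2)
  rw [mul_zero] at hbound
  refine (ENNReal.tendsto_toReal_iff (fun _ => measure_ne_top _ _) ENNReal.zero_ne_top).mp ?_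
  refine squeeze_zero' (Eventually.of_forall fun n => ENNReal.toReal_nonneg) ?_ hbound
  have hthreshold : (0 : ℝ) < (2 * (1 + ε) / ε)⁻¹ := by positivity
  filter_upwards [hinv.eventually_le_const hthreshold, eventually_ge_atTop 2] with n hlarge hn
  have hn₀ : n ≠ 0 := by omega
  exact measureReal_deviation_le (hm n) hn₀ hε
    ((expectedActive_le (hm n) hn).trans (sq_div_le_harmonicMean n (m n)))
    ((inv_le_inv₀ (harmonicMean_pos hn₀) (by positivity)).mp hlarge)

end Asymptotics

end Joining

theorem theorem1 :
    (∀ (ω : ℕ → ℝ) (m : ℕ → ℕ) (hm : ∀ n, m n ≤ n.choose 2),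
      Tendsto ω atTop atTop →
      (∀ᶠ n in atTop, (m n : ℝ) ≤ (n.choose 2 : ℝ) / ω n) →
      (∀ ε : ℝ, 0 < ε →
        Tendsto (fun n => (Joining.activeLaw n (m n) (hm n)).toMeasure
          {k : ℕ | ε * Joining.expectedActive n (m n) (hm n) ≤
            |(k : ℝ) - Joining.expectedActive n (m n) (hm n)|}) atTop (𝓝 0)) ∧
      (fun n => Joining.expectedActive n (m n) (hm n)) ~[atTop]
        (fun n => Joining.meanField n (m n)) ∧
      (fun n => Joining.expectedActive n (m n) (hm n)) ~[atTop]
        (fun n => (n : ℝ) ^ 2 / ((n : ℝ) + (m n : ℝ)))) ∧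
    (∀ (n m : ℕ) (hm : m ≤ n.choose 2), 2 ≤ n →
      Joining.expectedActive n m hm ≤ Joining.meanField n m) := by
  refine ⟨fun ω m hm hω hmω => ?_, fun _ _ => Joining.expectedActive_le_meanField⟩
  have hlim := Joining.tendsto_div_sq_zero hω hmω
  have hE := Joining.isEquivalent_expectedActive hm hlim
  have hF := Joining.isEquivalent_meanField hm hlim
  exact ⟨fun _ => Joining.tendsto_measure_deviation hm hlim, hE.trans hF.symm, hE⟩
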